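/- Let $d\ge 1$, $D=[0,1]^d$, $\Omega=D\times[0,1]$, and let $\mathcal F\subseteq C^1(\Omega,\mathbb R^d)$ with \[ \sup_{f\in\mathcal F}\|f\|_{C^1(\Omega)}=:M<\infty, \] where $\|f\|_{C^1(\Omega)}$ is the supremum over $\Omega$ of the absolute values of all components $f_j$ and of all their first-order partial derivatives (in $x_1,\dots,x_d$ and $t$). Suppose that each $f\in\mathcal F$ is tangential to the boundary, i.e. $f(x,t)\cdot\nu_x=0$ for all $t\in[0,1]$ and all $x\in\partial D$ at which the outward normal $\nu_x$ is well defined; or, more generally, that the flow lines of $f$ do not leave $D$, i.e. for every $x\in D$ the problem $\frac{d}{dt}X^f(x,t)=f(X^f(x,t),t)$, $X^f(x,0)=x$, has a solution $X^f(x,\cdot):[0,1]\to D$. Then for every $f\in\mathcal F$ and $x\in D$ this problem has exactly one solution $X^f(x,\cdot):[0,1]\to D$, the time-one flow map $T^f=X^f(\cdot,1):D\to D$ is differentiable, and for all $f\in\mathcal F$ \[ \sup_{x\in D}\|\nabla T^f(x)\|_2\le 1+dMe^{dM}, \] where $\|\cdot\|_2$ is the operator norm on Euclidean $\mathbb R^d$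 (derivatives at boundary points are taken relative to $D$). Consequently, the largest and smallest singular values $\lambda_1^f(x)$ and $\lambda_d^f(x)$ of $\nabla T^f(x)$ satisfy \[ \sup_{f\in\mathcal F}\sup_{x\in D}\lambda_1^f(x)\le 1+dMe^{dM}\qquad\text{and}\qquad \inf_{f\in\mathcal F}\inf_{x\in D}\lambda_d^f(x)\ge\bigl(1+dMe^{dM}\bigr)^{-1}. \] -/

import Mathlib

open Set
open scoped NNReal ENNReal

noncomputable section

namespace OdeFlow

/-- Euclidean space `ℝ^d`. -/
abbrev Euc (d : ℕ) : Type := EuclideanSpace ℝ (Fin d)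

/-- The closed unit cube `D = [0,1]^d`. -/
def cube (d : ℕ) : Set (Euc d) := {x | ∀ i, x i ∈ Icc (0 : ℝ) 1}

/-- The space-time cube `Ω = D × [0,1]`. -/
def spaceTime (d : ℕ) : Set (Euc d × ℝ) := cube d ×ˢ Icc (0 : ℝ) 1

/-- `f ∈ C¹(Ω, ℝ^d)`, with one-sided derivatives at the boundary of `Ω`. Only the values of `f`
on `Ω` matter, here and in all definitions below. -/
def IsC1 {d : ℕ} (f : Euc d × ℝ → Euc d) : Prop := ContDiffOn ℝ 1 f (spaceTime d)

/-- The `C¹(Ω)`-norm: the supremum over all components `f_j` and all points of `Ω` of the absolute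
values of `f_j`, of its partial derivatives in `x_1, …, x_d`, and of its partial derivative
in `t`. It takes values in `[0, ∞]`. -/
def c1Norm {d : ℕ} (f : Euc d × ℝ → Euc d) : ℝ≥0∞ :=
  ⨆ p ∈ spaceTime d, ⨆ j : Fin d,
    max ‖f p j‖ₑ
      (max (⨆ i : Fin d,
          ‖fderivWithin ℝ f (spaceTime d) p (EuclideanSpace.single i (1 : ℝ), 0) j‖ₑ)
        ‖fderivWithin ℝ f (spaceTime d) p (0, 1) j‖ₑ)

/-- `ν` is the outward unit normal of the cube at the boundary point `x`, where `x` lies in the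
relative interior of a face (exactly the boundary points at which the normal is well defined). -/
def IsOuterNormal {d : ℕ} (x ν : Euc d) : Prop :=
  ∃ i : Fin d, (∀ j, j ≠ i → x j ∈ Ioo (0 : ℝ) 1) ∧
    ((x i = 0 ∧ ν = -EuclideanSpace.single i (1 : ℝ)) ∨
      (x i = 1 ∧ ν = EuclideanSpace.single i (1 : ℝ)))

/-- `f(x,t) · ν_x = 0` for all `(x,t) ∈ ∂D × [0,1]` at which `ν_x` is well defined. -/
def IsTangential {d : ℕ} (f : Euc d × ℝ → Euc d) : Prop :=
  ∀ x ν : Euc d, IsOuterNormal x ν → ∀ t ∈ Icc (0 : ℝ) 1, inner ℝ (f (x, t)) ν = 0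

/-- `γ : [0,1] → D` solves `γ'(t) = f(γ(t), t)`, `γ(0) = x`. -/
def IsTrajectory {d : ℕ} (f : Euc d × ℝ → Euc d) (x : Euc d) (γ : ℝ → Euc d) : Prop :=
  γ 0 = x ∧ ∀ t ∈ Icc (0 : ℝ) 1,
    γ t ∈ cube d ∧ HasDerivWithinAt γ (f (γ t, t)) (Icc 0 1) t

/-- The flow lines of `f` do not leave `D`: from every `x ∈ D` there starts a solution of the
ODE on all of `[0,1]` with values in `D`. -/
def FlowStays {d : ℕ} (f : Euc d × ℝ → Euc d) : Prop :=
  ∀ x ∈ cube d, ∃ γ, IsTrajectory f x γ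

open Classical in
/-- The flow `X^f(x,t)`, i.e. the trajectory of `f` that starts at `x` (a constant default if
there is none). -/
def flow {d : ℕ} (f : Euc d × ℝ → Euc d) (x : Euc d) : ℝ → Euc d :=
  if h : ∃ γ, IsTrajectory f x γ then h.choose else fun _ => x

/-- The time-one flow map `T^f = X^f(·,1)`. -/
def transport {d : ℕ} (f : Euc d × ℝ → Euc d) (x : Euc d) : Euc d := flow f x 1

/-- The Jacobian `∇T^f(x)`, as a linear map of the Euclidean space `ℝ^d`; one-sided at boundary
points of `D`. -/
def jacobian {d : ℕ} (f : Euc d × ℝ → Euc d) (x : Euc d) : Euc d →L[ℝ] Euc d :=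
  fderivWithin ℝ (transport f) (cube d) x

end OdeFlow

end

/-! Along a trajectory, the derivative of the flow in the starting point solves the linear equation
`v' = A(t) v` with `A(t) = ∇ₓf(X(x,t), t)`, so the Jacobian of `T^f` is its time-one propagator.
Entries bounded by `M` give `‖A(t)‖ ≤ dM`, and Grönwall forward and backward in time yields
`e^{-dM}‖v‖ ≤ ‖Jv‖ ≤ e^{dM}‖v‖`. Singular values are attained stretching factors, and `e^a ≤ 1 + a
e^a` finishes.

That `J` is the derivative is `FlowStays.exists_hasFDerivWithinAt_transport`: uniform continuity of
`∇ₓf` on the compact `Ω` makes the linearization error small, and Grönwall carries this to time one.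
The tangential case reduces to the flow-line case in `IsTangential.flowStays`, by extending `f`
through the projection onto the cube. -/

noncomputable section

namespace OdeFlow

/-! ### Grönwall and Picard–Lindelöf on the unit interval -/

section General

variable {E : Type*} [NormedAddCommGroup E] [NormedSpace ℝ E]

/-- Grönwall's inequality on `[0,1]`. -/
lemma norm_le_gronwallBound_unitInterval {f f' : ℝ → E} {δ K ε : ℝ}
    (hf : ∀ t ∈ Icc (0 : ℝ) 1, HasDerivWithinAt f (f' t) (Icc 0 1) t) (h0 : ‖f 0‖ ≤ δ)
    (hb : ∀ t ∈ Icc (0 : ℝ) 1, ‖f' t‖ ≤ K * ‖f t‖ + ε) :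
    ∀ t ∈ Icc (0 : ℝ) 1, ‖f t‖ ≤ gronwallBound δ K ε t := by
  intro t ht
  have := norm_le_gronwallBound_of_norm_deriv_right_le (f := f) (f' := f') (δ := δ) (K := K)
    (ε := ε) (a := 0) (b := 1) (fun t ht => (hf t ht).continuousWithinAt)
    (fun t ht => (hf t (Ico_subset_Icc_self ht)).mono_of_mem_nhdsWithin
      (Icc_mem_nhdsGE_of_mem ht)) h0 (fun t ht => hb t (Ico_subset_Icc_self ht)) t ht
  simpa using this

lemma norm_le_mul_exp_of_norm_deriv_le {f f' : ℝ → E} {K : ℝ} (hK : 0 ≤ K)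
    (hf : ∀ t ∈ Icc (0 : ℝ) 1, HasDerivWithinAt f (f' t) (Icc 0 1) t)
    (hb : ∀ t ∈ Icc (0 : ℝ) 1, ‖f' t‖ ≤ K * ‖f t‖) :
    ∀ t ∈ Icc (0 : ℝ) 1, ‖f t‖ ≤ ‖f 0‖ * Real.exp K := by
  intro t ht
  have h := norm_le_gronwallBound_unitInterval (ε := 0) hf le_rfl (by simpa using hb) t ht
  rw [gronwallBound_ε0] at h
  refine h.trans ?_
  gcongr
  nlinarith [ht.1, ht.2]

/-- Time reversal `s ↦ 1 - s` of the forward estimate; this yields the smallest singular value. -/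
lemma norm_zero_le_mul_exp_of_norm_deriv_le {f f' : ℝ → E} {K : ℝ} (hK : 0 ≤ K)
    (hf : ∀ t ∈ Icc (0 : ℝ) 1, HasDerivWithinAt f (f' t) (Icc 0 1) t)
    (hb : ∀ t ∈ Icc (0 : ℝ) 1, ‖f' t‖ ≤ K * ‖f t‖) :
    ‖f 0‖ ≤ ‖f 1‖ * Real.exp K := by
  have hmaps : MapsTo (fun s : ℝ => 1 - s) (Icc 0 1) (Icc 0 1) := fun s hs =>
    ⟨by linarith [hs.2], by linarith [hs.1]⟩
  have h := norm_le_mul_exp_of_norm_deriv_le (f := fun s => f (1 - s))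
    (f' := fun s => (-1 : ℝ) • f' (1 - s)) hK
    (fun t ht => (hf (1 - t) (hmaps ht)).scomp t
      ((hasDerivWithinAt_id t _).const_sub 1) hmaps)
    (fun t ht => by simpa using hb (1 - t) (hmaps ht)) 1 (by simp)
  simpa using h

/-- A bounded, globally Lipschitz vector field has a solution on `[0,1]` from every point. -/
lemma exists_solution_of_bounded_lipschitz [CompleteSpace E] {g : ℝ → E → E} {K L : ℝ≥0}
    (hlip : ∀ t ∈ Icc (0 : ℝ) 1, LipschitzWith K (g t))
    (hcont : ∀ x, ContinuousOn (fun t => g t x) (Icc 0 1))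
    (hb : ∀ t ∈ Icc (0 : ℝ) 1, ∀ x, ‖g t x‖ ≤ L) (x₀ : E) :
    ∃ α : ℝ → E, α 0 = x₀ ∧
      ∀ t ∈ Icc (0 : ℝ) 1, HasDerivWithinAt α (g t (α t)) (Icc 0 1) t := by
  -- A field bounded by `L` moves a point at most `L` in unit time, so radius `L` reaches all of
  -- `[0,1]`.
  have h : IsPicardLindelof g (⟨0, by simp⟩ : Icc (0 : ℝ) 1) x₀ L 0 L K :=
    { lipschitzOnWith := fun t ht => (hlip t ht).lipschitzOnWith
      continuousOn := fun x _ => hcont x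
      norm_le := fun t ht x _ => hb t ht x
      mul_max_le := by simp }
  exact h.exists_eq_forall_mem_Icc_hasDerivWithinAt₀

end General

/-! ### Projection onto boxes -/

section Clamp

variable {d : ℕ}

/-- Coordinatewise projection of `ℝ^d` onto the box `[a,b]^d`. -/
def clamp (a b : ℝ) (x : Euc d) : Euc d := WithLp.toLp 2 fun i => max a (min b (x i))

@[simp]
lemma clamp_apply (a b : ℝ) (x : Euc d) (i : Fin d) : clamp a b x i = max a (min b (x i)) := rfl

lemma clamp_mem_cube (x : Euc d) : clamp 0 1 x ∈ cube d := fun i => by simp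

lemma clamp_eq_self {a b : ℝ} {x : Euc d} (h : ∀ i, x i ∈ Icc a b) : clamp a b x = x := by
  ext i
  simp [(h i).1, (h i).2]

lemma lipschitzWith_clamp (a b : ℝ) : LipschitzWith 1 (clamp a b : Euc d → Euc d) := by
  refine LipschitzWith.of_dist_le_mul fun x y => ?_
  rw [NNReal.coe_one, one_mul, EuclideanSpace.dist_eq, EuclideanSpace.dist_eq]
  gcongr with i
  rw [Real.dist_eq, Real.dist_eq, clamp_apply, clamp_apply, max_comm a, max_comm a, min_comm b,
    min_comm b]
  refine (abs_max_sub_max_le_abs _ _ _).trans ?_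
  simpa using abs_min_sub_min_le_max (x i) b (y i) b

lemma norm_clamp_neg_le {R : ℝ} (hR : 0 ≤ R) (x : Euc d) : ‖clamp (-R) R x‖ ≤ ‖x‖ := by
  have h := (lipschitzWith_clamp (d := d) (-R) R).dist_le_mul x 0
  have h0 : clamp (-R) R (0 : Euc d) = 0 := clamp_eq_self fun i => by simp [hR]
  simpa [h0] using h

lemma norm_clamp_neg_le_sqrt {R : ℝ} (hR : 0 ≤ R) (x : Euc d) :
    ‖clamp (-R) R x‖ ≤ √(∑ _i : Fin d, R ^ 2) := by
  rw [EuclideanSpace.norm_eq]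
  gcongr with i
  rw [Real.norm_eq_abs, clamp_apply, abs_le]
  exact ⟨le_max_left _ _, max_le (by linarith) (min_le_left _ _)⟩

end Clamp

/-! ### Linear equations and their propagators -/

section Linear

variable {d : ℕ}

/-- A linear ODE with continuous coefficients has a solution on `[0,1]` from every point. -/
lemma exists_solution_linear {A : ℝ → Euc d →L[ℝ] Euc d} (hA : ContinuousOn A (Icc 0 1)) {K : ℝ≥0}
    (hK : ∀ t ∈ Icc (0 : ℝ) 1, ‖A t‖ ≤ K) (v₀ : Euc d) :
    ∃ v : ℝ → Euc d, v 0 = v₀ ∧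
      ∀ t ∈ Icc (0 : ℝ) 1, HasDerivWithinAt v (A t (v t)) (Icc 0 1) t := by
  -- `R` is the a priori Grönwall bound. Truncating at `R` makes the field bounded, yet the solution
  -- never meets the truncation.
  set R : ℝ := ‖v₀‖ * Real.exp K with hR
  have hR0 : 0 ≤ R := by positivity
  obtain ⟨v, hv0, hv⟩ := exists_solution_of_bounded_lipschitz
    (g := fun t v => A t (clamp (-R) R v)) (K := K)
    (L := K * Real.toNNReal (√(∑ _i : Fin d, R ^ 2)))
    (fun t ht => by
      refine LipschitzWith.of_dist_le_mul fun x y => ?_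
      have h1 := (A t).le_of_opNorm_le (hK t ht) (clamp (-R) R x - clamp (-R) R y)
      have h2 := (lipschitzWith_clamp (-R) R).dist_le_mul x y
      rw [NNReal.coe_one, one_mul, dist_eq_norm] at h2
      rw [dist_eq_norm, ← map_sub]
      exact h1.trans (by gcongr))
    (fun x => hA.clm_apply continuousOn_const)
    (fun t ht x => by
      rw [NNReal.coe_mul, Real.coe_toNNReal _ (Real.sqrt_nonneg _)]
      refine ((A t).le_of_opNorm_le (hK t ht) _).trans ?_
      gcongr
      exact norm_clamp_neg_le_sqrt hR0 x) v₀
  have hbound := norm_le_mul_exp_of_norm_deriv_le K.2 hv fun t ht =>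
    ((A t).le_of_opNorm_le (hK t ht) _).trans 
      (mul_le_mul_of_nonneg_left (norm_clamp_neg_le hR0 _) K.2)
  refine ⟨v, hv0, fun t ht => ?_⟩
  have hc : clamp (-R) R (v t) = v t := clamp_eq_self fun i => by
    have h1 := (PiLp.norm_apply_le (v t) i).trans (hbound t ht)
    rw [hv0, Real.norm_eq_abs] at h1
    exact abs_le.1 h1
  simpa only [hc] using hv t ht

/-- The time-one propagator of a linear ODE. -/
lemma exists_propagator {A : ℝ → Euc d →L[ℝ] Euc d} (hA : ContinuousOn A (Icc 0 1)) {K : ℝ≥0}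
    (hK : ∀ t ∈ Icc (0 : ℝ) 1, ‖A t‖ ≤ K) :
    ∃ J : Euc d →L[ℝ] Euc d, ∀ v : ℝ → Euc d,
      (∀ t ∈ Icc (0 : ℝ) 1, HasDerivWithinAt v (A t (v t)) (Icc 0 1) t) → v 1 = J (v 0) := by
  choose S hS0 hS using exists_solution_linear hA hK
  have huniq : ∀ v w : ℝ → Euc d, v 0 = w 0 →
      (∀ t ∈ Icc (0 : ℝ) 1, HasDerivWithinAt v (A t (v t)) (Icc 0 1) t) →
      (∀ t ∈ Icc (0 : ℝ) 1, HasDerivWithinAt w (A t (w t)) (Icc 0 1) t) → v 1 = w 1 := by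
    intro v w h0 hv hw
    have h := norm_le_mul_exp_of_norm_deriv_le (f := fun t => v t - w t) K.2
      (fun t ht => (hv t ht).sub (hw t ht))
      (fun t ht => by
        rw [← map_sub]
        exact (A t).le_of_opNorm_le (hK t ht) _) 1 (by simp)
    rw [h0, sub_self, norm_zero, zero_mul, norm_le_zero_iff, sub_eq_zero] at h
    exact h
  -- Linearity follows from uniqueness: sums and multiples of solutions are solutions.
  let J : Euc d →ₗ[ℝ] Euc d :=
    { toFun := fun v => S v 1
      map_add' := fun x y => huniq _ (fun t => S x t + S y t) (by simp [hS0]) (hS _)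
        (fun t ht => by
          rw [map_add]
          exact (hS x t ht).add (hS y t ht))
      map_smul' := fun c x => huniq _ (fun t => c • S x t) (by simp [hS0]) (hS _)
        (fun t ht => by
          rw [map_smul]
          exact (hS x t ht).const_smul c) }
  refine ⟨LinearMap.toContinuousLinearMap J, fun v hv => ?_⟩
  exact huniq v (S (v 0)) (hS0 _).symm hv (hS _)

end Linear

/-! ### Singular values as stretching factors -/

section SingularValues

/-- Every singular value is attained as a stretching factor. -/
lemma exists_norm_map_eq_singularValue_mul {E F : Type*} [NormedAddCommGroup E]
    [InnerProductSpace ℝ E] [FiniteDimensional ℝ E] [NormedAddCommGroup F]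
    [InnerProductSpace ℝ F] [FiniteDimensional ℝ F] (T : E →ₗ[ℝ] F) {n : ℕ}
    (hn : n < Module.finrank ℝ E) : ∃ v : E, v ≠ 0 ∧ ‖T v‖ = T.singularValues n * ‖v‖ := by
  obtain ⟨v, hv, hv0⟩ := (T.hasEigenvalue_adjoint_comp_self_sq_singularValues hn).exists_hasEigenvector
  refine ⟨v, hv0, ?_⟩
  have h1 : (LinearMap.adjoint T ∘ₗ T) v = T.singularValues n ^ 2 • v :=
    Module.End.mem_eigenspace_iff.1 hv
  have h2 : ‖T v‖ ^ 2 = (T.singularValues n * ‖v‖) ^ 2 := by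
    rw [← real_inner_self_eq_norm_sq, ← LinearMap.adjoint_inner_left, ← LinearMap.comp_apply, h1,
      real_inner_smul_left, real_inner_self_eq_norm_sq, mul_pow]
  exact (pow_left_inj₀ (norm_nonneg _)
    (mul_nonneg (T.singularValues_nonneg n) (norm_nonneg _)) two_ne_zero).1 h2

end SingularValues

/-! ### Geometry of the cube -/

section Cube

variable {d : ℕ}

lemma convex_cube : Convex ℝ (cube d) := by
  intro x hx y hy a b ha hb hab i
  simpa using convex_Icc (0 : ℝ) 1 (hx i) (hy i) ha hb hab

lemma isCompact_cube : IsCompact (cube d) := by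
  have h : cube d = (PiLp.homeomorph 2 fun _ : Fin d => ℝ) ⁻¹' univ.pi fun _ => Icc (0 : ℝ) 1 := by
    ext x
    exact ⟨fun h i _ => h i, fun h i => h i (mem_univ i)⟩
  rw [h, Homeomorph.isCompact_preimage]
  exact isCompact_univ_pi fun _ => isCompact_Icc

lemma nonempty_interior_cube : (interior (cube d)).Nonempty := by
  have h : IsOpen ((PiLp.homeomorph 2 fun _ : Fin d => ℝ) ⁻¹' univ.pi fun _ => Ioo (0 : ℝ) 1) :=
    (isOpen_set_pi finite_univ fun _ _ => isOpen_Ioo).preimage (Homeomorph.continuous _)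
  refine ⟨WithLp.toLp 2 fun _ => 1 / 2, mem_interior.2 ⟨_, fun x hx i => ?_, h, ?_⟩⟩
  · exact Ioo_subset_Icc_self (hx i (mem_univ i))
  · intro i _
    simp only [PiLp.homeomorph]
    norm_num

lemma uniqueDiffOn_cube : UniqueDiffOn ℝ (cube d) :=
  uniqueDiffOn_convex convex_cube nonempty_interior_cube

lemma isCompact_spaceTime : IsCompact (spaceTime d) := isCompact_cube.prod isCompact_Icc

lemma uniqueDiffOn_spaceTime : UniqueDiffOn ℝ (spaceTime d) :=
  uniqueDiffOn_cube.prod (uniqueDiffOn_Icc zero_lt_one)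

end Cube

/-! ### Bounds on the spatial derivative -/

section SpatialDerivative

variable {d : ℕ} {f : Euc d × ℝ → Euc d}

/-- The derivative of `f` in the space variable. -/
def spatialDeriv (f : Euc d × ℝ → Euc d) (p : Euc d × ℝ) : Euc d →L[ℝ] Euc d :=
  (fderivWithin ℝ f (spaceTime d) p).comp (ContinuousLinearMap.inl ℝ (Euc d) ℝ)

lemma IsC1.hasFDerivWithinAt_space (hf : IsC1 f) {x : Euc d} (hx : x ∈ cube d) {t : ℝ}
    (ht : t ∈ Icc (0 : ℝ) 1) :
    HasFDerivWithinAt (fun y => f (y, t)) (spatialDeriv f (x, t)) (cube d) x := by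
  have h1 : HasFDerivWithinAt f (fderivWithin ℝ f (spaceTime d) (x, t)) (spaceTime d) (x, t) :=
    ((hf.differentiableOn one_ne_zero) (x, t) ⟨hx, ht⟩).hasFDerivWithinAt
  have h2 : HasFDerivWithinAt (fun y : Euc d => (y, t)) (ContinuousLinearMap.inl ℝ (Euc d) ℝ)
      (cube d) x := (hasFDerivAt_prodMk_left x t).hasFDerivWithinAt
  exact h1.comp x h2 fun y hy => mk_mem_prod hy ht

lemma IsC1.continuousOn_spatialDeriv (hf : IsC1 f) :
    ContinuousOn (spatialDeriv f) (spaceTime d) :=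
  (hf.continuousOn_fderivWithin uniqueDiffOn_spaceTime le_rfl).clm_comp continuousOn_const

/-- Cauchy–Schwarz bounds each squared component of `L v` by `d M² ‖v‖²`; summing `d` of them gives
`(d M ‖v‖)²`. -/
lemma norm_le_of_abs_entries_le {L : Euc d →L[ℝ] Euc d} {M : ℝ≥0}
    (h : ∀ i j, |L (EuclideanSpace.single i 1) j| ≤ M) : ‖L‖ ≤ d * M := by
  refine L.opNorm_le_bound (by positivity) fun v => ?_
  have hv : L v = ∑ i, v i • L (EuclideanSpace.single i 1) := by
    conv_lhs => rw [← (EuclideanSpace.basisFun (Fin d) ℝ).sum_repr v]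
    simp
  have hj : ∀ j, (L v j) ^ 2 ≤ d * M ^ 2 * ‖v‖ ^ 2 := by
    intro j
    have h1 : L v j = ∑ i, v i * L (EuclideanSpace.single i 1) j := by
      rw [hv]
      simp
    rw [h1, EuclideanSpace.norm_sq_eq]
    refine (Finset.sum_mul_sq_le_sq_mul_sq _ _ _).trans ?_
    rw [mul_comm]
    simp only [Real.norm_eq_abs, sq_abs]
    gcongr
    calc ∑ i, (L (EuclideanSpace.single i 1) j) ^ 2 ≤ ∑ _i : Fin d, (M : ℝ) ^ 2 := by
          refine Finset.sum_le_sum fun i _ => ?_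
          rw [← sq_abs]
          have := h i j
          gcongr
      _ = d * M ^ 2 := by simp
  have h2 : ‖L v‖ ^ 2 ≤ (d * M * ‖v‖) ^ 2 := by
    rw [EuclideanSpace.norm_sq_eq]
    calc ∑ j, ‖L v j‖ ^ 2 ≤ ∑ _j : Fin d, d * (M : ℝ) ^ 2 * ‖v‖ ^ 2 := by
          refine Finset.sum_le_sum fun j _ => ?_
          rw [Real.norm_eq_abs, sq_abs]
          exact hj j
      _ = (d * M * ‖v‖) ^ 2 := by simp; ring
  exact le_of_sq_le_sq h2 (by positivity)

lemma norm_spatialDeriv_le {M : ℝ≥0} (hM : c1Norm f ≤ M) {p : Euc d × ℝ} (hp : p ∈ spaceTime d) :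
    ‖spatialDeriv f p‖ ≤ d * M := by
  refine norm_le_of_abs_entries_le fun i j => ?_
  have h1 : ‖fderivWithin ℝ f (spaceTime d) p (EuclideanSpace.single i (1 : ℝ), 0) j‖ₑ ≤ M :=
    calc _ ≤ ⨆ i : Fin d,
          ‖fderivWithin ℝ f (spaceTime d) p (EuclideanSpace.single i (1 : ℝ), 0) j‖ₑ :=
          le_iSup (fun i : Fin d =>
            ‖fderivWithin ℝ f (spaceTime d) p (EuclideanSpace.single i (1 : ℝ), 0) j‖ₑ) i
      _ ≤ _ := (le_max_left _ _).trans (le_max_right _ _)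
      _ ≤ _ := le_iSup (fun j : Fin d => max ‖f p j‖ₑ
      (max (⨆ i : Fin d,
          ‖fderivWithin ℝ f (spaceTime d) p (EuclideanSpace.single i (1 : ℝ), 0) j‖ₑ)
        ‖fderivWithin ℝ f (spaceTime d) p (0, 1) j‖ₑ)) j
      _ ≤ c1Norm f := le_iSup₂_of_le p hp le_rfl
      _ ≤ M := hM
  rw [enorm_eq_nnnorm, ENNReal.coe_le_coe, ← NNReal.coe_le_coe, coe_nnnorm, Real.norm_eq_abs] at h1
  simpa [spatialDeriv] using h1

lemma IsC1.lipschitzOnWith_space (hf : IsC1 f) {M : ℝ≥0} (hM : c1Norm f ≤ M) {t : ℝ}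
    (ht : t ∈ Icc (0 : ℝ) 1) : LipschitzOnWith (d * M) (fun y => f (y, t)) (cube d) :=
  convex_cube.lipschitzOnWith_of_nnnorm_hasFDerivWithin_le
    (fun _ hx => hf.hasFDerivWithinAt_space hx ht)
    fun _ hx => by
      rw [← NNReal.coe_le_coe]
      simpa using norm_spatialDeriv_le hM ⟨hx, ht⟩

lemma IsC1.norm_sub_le_space (hf : IsC1 f) {M : ℝ≥0} (hM : c1Norm f ≤ M) {t : ℝ}
    (ht : t ∈ Icc (0 : ℝ) 1) {x y : Euc d} (hx : x ∈ cube d) (hy : y ∈ cube d) :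
    ‖f (x, t) - f (y, t)‖ ≤ d * M * ‖x - y‖ := by
  simpa [dist_eq_norm] using (hf.lipschitzOnWith_space hM ht).dist_le_mul x hx y hy

end SpatialDerivative

/-! ### Tangential fields keep the cube invariant -/

section Existence

variable {d : ℕ} {f : Euc d × ℝ → Euc d}

/-- A tangential field has vanishing normal component on the closed faces of the cube. -/
lemma IsTangential.apply_eq_zero (hf : IsTangential f) (hC : IsC1 f) {x : Euc d}
    (hx : x ∈ cube d) {i : Fin d} (hi : x i = 0 ∨ x i = 1) {t : ℝ} (ht : t ∈ Icc (0 : ℝ) 1) :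
    f (x, t) i = 0 := by
  -- Move `x` within its face towards the face's centre: for `0 < s < 1` the normal exists, and `s →
  -- 0` recovers `x` by continuity.
  let y : ℝ → Euc d := fun s =>
    WithLp.toLp 2 fun j => if j = i then x i else (1 - s) * x j + s / 2
  have hyi : ∀ s, y s i = x i := fun s => if_pos rfl
  have hyj : ∀ s j, j ≠ i → y s j = (1 - s) * x j + s / 2 := fun s j hj => if_neg hj
  have hy0 : y 0 = x := by
    ext j
    by_cases hj : j = i
    · rw [hj, hyi]
    · simp [hyj 0 j hj]
  have hymem : ∀ s ∈ Icc (0 : ℝ) 1, y s ∈ cube d := by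
    intro s hs j
    by_cases hj : j = i
    · rw [hj, hyi]
      exact hx i
    · rw [hyj s j hj]
      have := hx j
      constructor <;> nlinarith [this.1, this.2, hs.1, hs.2]
  have hycont : Continuous y := by
    refine (PiLp.continuous_toLp 2 _).comp (continuous_pi fun j => ?_)
    by_cases hj : j = i
    · simp only [hj, if_true]
      fun_prop
    · simp only [hj, if_false]
      fun_prop
  have hcont : ContinuousOn (fun s => f (y s, t) i) (Icc 0 1) := by
    have h1 : ContinuousOn (fun s => f (y s, t)) (Icc 0 1) :=
      hC.continuousOn.comp (hycont.prodMk continuous_const).continuousOn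
        fun s hs => ⟨hymem s hs, ht⟩
    exact (EuclideanSpace.proj (𝕜 := ℝ) i).continuous.comp_continuousOn h1
  have hzero : ∀ s ∈ Ioo (0 : ℝ) 1, f (y s, t) i = 0 := by
    intro s hs
    have hin : ∀ j, j ≠ i → y s j ∈ Ioo (0 : ℝ) 1 := by
      intro j hj
      rw [hyj s j hj]
      have := hx j
      constructor <;> nlinarith [this.1, this.2, hs.1, hs.2]
    rcases hi with hi | hi
    · have := hf (y s) (-EuclideanSpace.single i 1)
        ⟨i, hin, Or.inl ⟨by rw [hyi, hi], rfl⟩⟩ t ht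
      simpa [EuclideanSpace.inner_single_right] using this
    · have := hf (y s) (EuclideanSpace.single i 1)
        ⟨i, hin, Or.inr ⟨by rw [hyi, hi], rfl⟩⟩ t ht
      simpa [EuclideanSpace.inner_single_right] using this
  have hlim := (hcont 0 (by simp)).mono_left (nhdsWithin_mono 0 Ioo_subset_Icc_self)
  have hne : (nhdsWithin (0 : ℝ) (Ioo 0 1)).NeBot := left_nhdsWithin_Ioo_neBot zero_lt_one
  have h0 : Filter.Tendsto (fun s => f (y s, t) i) (nhdsWithin 0 (Ioo 0 1)) (nhds 0) :=
    tendsto_const_nhds.congr' (Filter.eventually_of_mem self_mem_nhdsWithin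
      fun s hs => (hzero s hs).symm)
  have := tendsto_nhds_unique hlim h0
  simpa only [hy0] using this

/-- A function whose derivative vanishes wherever its value exceeds `1` stays below `1`. -/
lemma le_one_of_deriv_eq_zero {u u' : ℝ → ℝ}
    (hu : ∀ t ∈ Icc (0 : ℝ) 1, HasDerivWithinAt u (u' t) (Icc 0 1) t) (h0 : u 0 ≤ 1)
    (h : ∀ t ∈ Icc (0 : ℝ) 1, 1 ≤ u t → u' t = 0) : ∀ t ∈ Icc (0 : ℝ) 1, u t ≤ 1 := by
  intro t ht
  refine le_of_forall_pos_le_add fun ε hε => ?_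
  -- At contact with the barrier `1 + ε s`, the slope of `u` is `0 < ε`.
  have key := image_le_of_deriv_right_lt_deriv_boundary (f := u) (f' := u') (a := 0) (b := 1)
    (B := fun s => 1 + ε * s) (B' := fun _ => ε) (fun s hs => (hu s hs).continuousWithinAt)
    (fun s hs => (hu s (Ico_subset_Icc_self hs)).mono_of_mem_nhdsWithin
      (Icc_mem_nhdsGE_of_mem hs)) (by simpa using h0)
    (fun s => by simpa using ((hasDerivAt_id s).const_mul ε).const_add 1)
    (fun s hs he => by
      rw [h s (Ico_subset_Icc_self hs) (by rw [he]; nlinarith [hs.1])]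
      exact hε) ht
  refine key.trans ?_
  nlinarith [ht.2]

/-- The flow lines of a tangential field do not leave the cube. -/
lemma IsTangential.flowStays (hf : IsTangential f) (hC : IsC1 f) {M : ℝ≥0} (hM : c1Norm f ≤ M) :
    FlowStays f := by
  intro x hx
  obtain ⟨C, hC0⟩ := isCompact_spaceTime.exists_bound_of_continuousOn hC.continuousOn
  obtain ⟨γ, hγ0, hγ⟩ := exists_solution_of_bounded_lipschitz
    (g := fun t y => f (clamp 0 1 y, t)) (K := d * M * 1) (L := C.toNNReal)
    (fun t ht => lipschitzOnWith_univ.1 ((hC.lipschitzOnWith_space hM ht).comp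
      (lipschitzWith_clamp 0 1).lipschitzOnWith fun y _ => clamp_mem_cube y))
    (fun y => hC.continuousOn.comp (by fun_prop) fun t ht => ⟨clamp_mem_cube y, ht⟩)
    (fun t ht y => (hC0 _ ⟨clamp_mem_cube y, ht⟩).trans (Real.le_coe_toNNReal C)) x
  have hcoord : ∀ i, ∀ t ∈ Icc (0 : ℝ) 1,
      HasDerivWithinAt (fun s => γ s i) (f (clamp 0 1 (γ t), t) i) (Icc 0 1) t := fun i t ht =>
    (EuclideanSpace.proj (𝕜 := ℝ) i).hasFDerivAt.comp_hasDerivWithinAt t (hγ t ht)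
  -- A coordinate outside `(0,1)` is clamped onto a face, where its velocity vanishes, so it cannot
  -- escape.
  have hmem : ∀ t ∈ Icc (0 : ℝ) 1, γ t ∈ cube d := by
    intro t ht i
    constructor
    · have := le_one_of_deriv_eq_zero (u := fun s => 1 - γ s i)
        (u' := fun s => -(f (clamp 0 1 (γ s), s) i))
        (fun s hs => (hcoord i s hs).const_sub 1) (by simpa [hγ0] using (hx i).1)
        (fun s hs h1 => by
          rw [hf.apply_eq_zero hC (clamp_mem_cube _) (Or.inl ?_) hs, neg_zero]
          have h2 : γ s i ≤ 0 := by simpa using h1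
          simp [h2]) t ht
      simpa using this
    · exact le_one_of_deriv_eq_zero (hcoord i) (by simpa [hγ0] using (hx i).2)
        (fun s hs h1 => hf.apply_eq_zero hC (clamp_mem_cube _) (Or.inr (by simp [h1])) hs) t ht
  refine ⟨γ, hγ0, fun t ht => ⟨hmem t ht, ?_⟩⟩
  simpa only [clamp_eq_self (hmem t ht)] using hγ t ht

end Existence

/-! ### Dependence of trajectories on the starting point -/

section Trajectories

variable {d : ℕ} {f : Euc d × ℝ → Euc d}

lemma IsTrajectory.continuousOn {x : Euc d} {γ : ℝ → Euc d} (h : IsTrajectory f x γ) :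
    ContinuousOn γ (Icc 0 1) := fun t ht => (h.2 t ht).2.continuousWithinAt

/-- Trajectories depend Lipschitz continuously on the starting point. -/
lemma IsTrajectory.norm_sub_le (hC : IsC1 f) {M : ℝ≥0} (hM : c1Norm f ≤ M) {x y : Euc d}
    {γ η : ℝ → Euc d} (hγ : IsTrajectory f x γ) (hη : IsTrajectory f y η) :
    ∀ t ∈ Icc (0 : ℝ) 1, ‖γ t - η t‖ ≤ ‖x - y‖ * Real.exp (d * M) := by
  have h := norm_le_mul_exp_of_norm_deriv_le (f := fun t => γ t - η t) (K := d * M)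
    (by positivity) (fun t ht => (hγ.2 t ht).2.sub (hη.2 t ht).2)
    (fun t ht => hC.norm_sub_le_space hM ht (hγ.2 t ht).1 (hη.2 t ht).1)
  simpa only [hγ.1, hη.1] using h

lemma IsTrajectory.eqOn (hC : IsC1 f) {M : ℝ≥0} (hM : c1Norm f ≤ M) {x : Euc d}
    {γ η : ℝ → Euc d} (hγ : IsTrajectory f x γ) (hη : IsTrajectory f x η) :
    EqOn γ η (Icc 0 1) := fun t ht => by
  have h := hγ.norm_sub_le hC hM hη t ht
  rwa [sub_self, norm_zero, zero_mul, norm_le_zero_iff, sub_eq_zero] at h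

lemma FlowStays.isTrajectory_flow (hf : FlowStays f) {x : Euc d} (hx : x ∈ cube d) :
    IsTrajectory f x (flow f x) := by
  rw [flow, dif_pos (hf x hx)]
  exact (hf x hx).choose_spec

/-- The linearization error of `f` in space is uniformly small near the diagonal. -/
lemma IsC1.exists_linearization_bound (hC : IsC1 f) {ε : ℝ} (hε : 0 < ε) :
    ∃ δ > 0, ∀ t ∈ Icc (0 : ℝ) 1, ∀ x ∈ cube d, ∀ y ∈ cube d, ‖y - x‖ < δ →
      ‖f (y, t) - f (x, t) - spatialDeriv f (x, t) (y - x)‖ ≤ ε * ‖y - x‖ := by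
  have huc := isCompact_spaceTime.uniformContinuousOn_of_continuous hC.continuousOn_spatialDeriv
  obtain ⟨δ, hδ, h⟩ := Metric.uniformContinuousOn_iff.1 huc ε hε
  refine ⟨δ, hδ, fun t ht x hx y hy hxy => ?_⟩
  -- Mean value inequality on this convex set, where the derivative varies by at most `ε` from its
  -- value at `x`.
  have hsub : cube d ∩ Metric.ball x δ ⊆ cube d := inter_subset_left
  refine Convex.norm_image_sub_le_of_norm_hasFDerivWithin_le'
    (f := fun z => f (z, t)) (f' := fun z => spatialDeriv f (z, t))
    (s := cube d ∩ Metric.ball x δ)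
    (fun z hz => (hC.hasFDerivWithinAt_space hz.1 ht).mono hsub) (fun z hz => ?_)
    (convex_cube.inter (convex_ball x δ)) ⟨hx, Metric.mem_ball_self hδ⟩
    ⟨hy, by rwa [Metric.mem_ball, dist_eq_norm]⟩
  rw [← dist_eq_norm]
  refine (h (z, t) ⟨hz.1, ht⟩ (x, t) ⟨hx, ht⟩ ?_).le
  rw [Prod.dist_eq, dist_self, max_eq_left dist_nonneg]
  exact hz.2

lemma gronwallBound_zero_mul (K ε x : ℝ) :
    gronwallBound 0 K ε x = ε * gronwallBound 0 K 1 x := by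
  unfold gronwallBound
  split_ifs <;> ring

/-- The time-one flow map is differentiable relative to the cube, and its derivative is the
time-one propagator of the linearized equation. -/
lemma FlowStays.exists_hasFDerivWithinAt_transport (hf : FlowStays f) (hC : IsC1 f) {M : ℝ≥0}
    (hM : c1Norm f ≤ M) {x : Euc d} (hx : x ∈ cube d) :
    ∃ J : Euc d →L[ℝ] Euc d, HasFDerivWithinAt (transport f) J (cube d) x ∧
      ∀ v, ‖J v‖ ≤ ‖v‖ * Real.exp (d * M) ∧ ‖v‖ ≤ ‖J v‖ * Real.exp (d * M) := by
  have hX := hf.isTrajectory_flow hx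
  set A : ℝ → Euc d →L[ℝ] Euc d := fun t => spatialDeriv f (flow f x t, t) with hA
  have hAcont : ContinuousOn A (Icc 0 1) :=
    hC.continuousOn_spatialDeriv.comp (hX.continuousOn.prodMk continuousOn_id)
      fun t ht => ⟨(hX.2 t ht).1, ht⟩
  have hAK : ∀ t ∈ Icc (0 : ℝ) 1, ‖A t‖ ≤ ((d * M : ℝ≥0) : ℝ) := fun t ht => by
    simpa using norm_spatialDeriv_le hM ⟨(hX.2 t ht).1, ht⟩
  have hAK' : ∀ t ∈ Icc (0 : ℝ) 1, ∀ v, ‖A t v‖ ≤ d * M * ‖v‖ := fun t ht v => by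
    simpa using (A t).le_of_opNorm_le (hAK t ht) v
  have hK : (0 : ℝ) ≤ d * M := by positivity
  obtain ⟨J, hJ⟩ := exists_propagator hAcont hAK
  refine ⟨J, .of_isLittleO (Asymptotics.isLittleO_iff.2 fun c hc => ?_), fun v => ?_⟩
  · set G := gronwallBound 0 (d * M) 1 1
    set E := Real.exp (d * M)
    have hE : 0 < E := Real.exp_pos _
    have hG : 0 < |G| + 1 := by positivity
    -- `E` is the Lipschitz factor of the flow and `G` the Grönwall factor; the `+ 1` avoids
    -- division by zero. Starting points within `δ / E` stay `δ`-close.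
    obtain ⟨δ, hδ, hlin⟩ := hC.exists_linearization_bound
      (ε := c / (E * (|G| + 1))) (by positivity)
    filter_upwards [self_mem_nhdsWithin,
      mem_nhdsWithin_of_mem_nhds (Metric.ball_mem_nhds x (div_pos hδ hE))] with y hy hyx
    rw [Metric.mem_ball, dist_eq_norm, lt_div_iff₀ hE] at hyx
    have hY := hf.isTrajectory_flow hy
    obtain ⟨v, hv0, hv⟩ := exists_solution_linear hAcont hAK (y - x)
    have hw := norm_le_gronwallBound_unitInterval
      (f := fun t => flow f y t - flow f x t - v t) (δ := 0) (K := d * M)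
      (ε := c / (E * (|G| + 1)) * (‖y - x‖ * E))
      (fun t ht => ((hY.2 t ht).2.sub (hX.2 t ht).2).sub (hv t ht))
      (by simp [hX.1, hY.1, hv0])
      (fun t ht => by
        have h1 := hY.norm_sub_le hC hM hX t ht
        have h2 := hlin t ht _ (hX.2 t ht).1 _ (hY.2 t ht).1 (h1.trans_lt hyx)
        -- Linear part acting on the error, plus the linearization defect of `f`.
        have h3 : f (flow f y t, t) - f (flow f x t, t) - A t (v t) =
            A t (flow f y t - flow f x t - v t) +
              (f (flow f y t, t) - f (flow f x t, t) - A t (flow f y t - flow f x t)) := by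
          rw [map_sub (A t) (flow f y t - flow f x t)]
          abel
        rw [h3]
        refine (norm_add_le _ _).trans (add_le_add (hAK' t ht _) (h2.trans ?_))
        gcongr) 1 (by simp)
    rw [gronwallBound_zero_mul] at hw
    have hv1 : v 1 = J (y - x) := by rw [hJ v hv, hv0]
    rw [hv1] at hw
    refine hw.trans ?_
    calc c / (E * (|G| + 1)) * (‖y - x‖ * E) * G
        = c * ‖y - x‖ * (G / (|G| + 1)) := by field_simp
      _ ≤ c * ‖y - x‖ * 1 := by
          gcongr
          rw [div_le_one hG]
          linarith [le_abs_self G]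
      _ = c * ‖y - x‖ := mul_one _
  · obtain ⟨w, hw0, hw⟩ := exists_solution_linear hAcont hAK v
    have h1 := norm_le_mul_exp_of_norm_deriv_le hK hw (fun t ht => hAK' t ht _) 1 (by simp)
    have h2 := norm_zero_le_mul_exp_of_norm_deriv_le hK hw (fun t ht => hAK' t ht _)
    rw [hJ w hw, hw0] at h1 h2
    exact ⟨h1, h2⟩

/-- Multiply `1 - a ≤ e^{-a}` by `e^a`. -/
lemma exp_le_one_add_mul_exp (a : ℝ) : Real.exp a ≤ 1 + a * Real.exp a := by
  have h1 := Real.add_one_le_exp (-a)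
  have h2 : Real.exp (-a) * Real.exp a = 1 := by rw [← Real.exp_add]; simp
  nlinarith [Real.exp_pos a]

end Trajectories

end OdeFlow

end

theorem mainTheorem11 (d : ℕ) (hd : 1 ≤ d)
    (F : Set (OdeFlow.Euc d × ℝ → OdeFlow.Euc d))
    (hC1 : ∀ f ∈ F, OdeFlow.IsC1 f)
    (hflow : ∀ f ∈ F, OdeFlow.IsTangential f ∨ OdeFlow.FlowStays f)
    (M : ℝ≥0) (hM : (⨆ f ∈ F, OdeFlow.c1Norm f) = (M : ℝ≥0∞)) :
    -- each flow map is well defined and differentiable on the cube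
    (∀ f ∈ F,
      (∀ x ∈ OdeFlow.cube d, OdeFlow.IsTrajectory f x (OdeFlow.flow f x) ∧
        ∀ γ, OdeFlow.IsTrajectory f x γ → EqOn γ (OdeFlow.flow f x) (Icc 0 1)) ∧
      DifferentiableOn ℝ (OdeFlow.transport f) (OdeFlow.cube d)) ∧
    -- operator norm of the Jacobian
    (∀ f ∈ F, ∀ x ∈ OdeFlow.cube d,
      ‖OdeFlow.jacobian f x‖ ≤ 1 + (d : ℝ) * (M : ℝ) * Real.exp ((d : ℝ) * (M : ℝ))) ∧
    -- largest singular value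
    (∀ f ∈ F, ∀ x ∈ OdeFlow.cube d,
      (OdeFlow.jacobian f x).toLinearMap.singularValues 0
        ≤ 1 + (d : ℝ) * (M : ℝ) * Real.exp ((d : ℝ) * (M : ℝ))) ∧
    -- smallest singular value
    (∀ f ∈ F, ∀ x ∈ OdeFlow.cube d,
      (1 + (d : ℝ) * (M : ℝ) * Real.exp ((d : ℝ) * (M : ℝ)))⁻¹
        ≤ (OdeFlow.jacobian f x).toLinearMap.singularValues (d - 1)) := by
  open OdeFlow in
  have hnorm : ∀ f ∈ F, c1Norm f ≤ M := fun f hf => hM ▸ le_iSup₂_of_le f hf le_rfl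
  have hstay : ∀ f ∈ F, FlowStays f := fun f hf =>
    (hflow f hf).elim (fun h => h.flowStays (hC1 f hf) (hnorm f hf)) id
  have hexp := exp_le_one_add_mul_exp ((d : ℝ) * M)
  have hpos : (0 : ℝ) < 1 + (d : ℝ) * M * Real.exp (d * M) := by positivity
  have hjac : ∀ f ∈ F, ∀ x ∈ cube d, ∀ v,
      ‖jacobian f x v‖ ≤ (1 + (d : ℝ) * M * Real.exp (d * M)) * ‖v‖ ∧
        ‖v‖ ≤ (1 + (d : ℝ) * M * Real.exp (d * M)) * ‖jacobian f x v‖ := by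
    intro f hf x hx v
    obtain ⟨J, hJ, hbound⟩ :=
      (hstay f hf).exists_hasFDerivWithinAt_transport (hC1 f hf) (hnorm f hf) hx
    rw [jacobian, hJ.fderivWithin (uniqueDiffOn_cube x hx)]
    refine ⟨(hbound v).1.trans ?_, (hbound v).2.trans ?_⟩ <;>
    · rw [mul_comm]
      gcongr
  have hfin : ∀ n < d, n < Module.finrank ℝ (Euc d) := fun n hn => by simpa using hn
  refine ⟨fun f hf => ⟨fun x hx => ?_, fun x hx => ?_⟩, fun f hf x hx => ?_, fun f hf x hx => ?_,
    fun f hf x hx => ?_⟩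
  · have h := (hstay f hf).isTrajectory_flow hx
    exact ⟨h, fun γ hγ => hγ.eqOn (hC1 f hf) (hnorm f hf) h⟩
  · obtain ⟨J, hJ, -⟩ :=
      (hstay f hf).exists_hasFDerivWithinAt_transport (hC1 f hf) (hnorm f hf) hx
    exact hJ.differentiableWithinAt
  · exact (jacobian f x).opNorm_le_bound hpos.le fun v => (hjac f hf x hx v).1
  · obtain ⟨v, hv0, hv⟩ := exists_norm_map_eq_singularValue_mul
      (jacobian f x).toLinearMap (hfin 0 (by omega))
    have h := (hjac f hf x hx v).1
    rw [← ContinuousLinearMap.coe_coe, hv] at h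
    exact le_of_mul_le_mul_right h (norm_pos_iff.2 hv0)
  -- Indices start at zero, so the smallest singular value has index `d - 1`, which is below `d`
  -- because `1 ≤ d`.
  · obtain ⟨v, hv0, hv⟩ := exists_norm_map_eq_singularValue_mul
      (jacobian f x).toLinearMap (hfin (d - 1) (by omega))
    have h := (hjac f hf x hx v).2
    rw [← ContinuousLinearMap.coe_coe, hv, ← mul_assoc] at h
    rw [inv_le_iff_one_le_mul₀' hpos]
    exact le_of_mul_le_mul_right (by rwa [one_mul]) (norm_pos_iff.2 hv0)
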